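/- Let $k\ge 1$. Consider directed graphs $G=(V,E)$ on finite non-empty domains, $E\subseteq V\times V$. The Boolean query $(k+2)$-Clique holds in $G$ if there are $k+2$ pairwise distinct nodes $v_1,\dots,v_{k+2}\in V$ such that $(v_i,v_j)\in E$ or $(v_j,v_i)\in E$ for all $i\neq j$. An auxiliary schema $\tau_{\mathrm{aux}}$ consists of relation symbols and function symbols; let $\tau=\{E\}\cup\tau_{\mathrm{aux}}$. *Update terms* and *quantifier-free update formulas* over $\tau$ are built by simultaneous recursion: terms from variables, function symbols and $\mathrm{ITE}(\varphi,t_1,t_2)$ (whose value is that of $t_1$ if $\varphi$ holds and that of $t_2$ otherwise), where $\varphi$ is a quantifier-free formula; formulas from equalities of terms and relation symbols applied to terms, by Boolean connectives. A *quantifier-free dynamic program* consists of * for each $\delta\in\{\mathrm{ins}_E,\mathrm{del}_E\}$, each relation symbol $R\in\tau_{\mathrm{aux}}$ and each function symbol $f\in\tau_{\mathrm{aux}}$, a quantifier-free update formula $\phi^R_\delta(u,v;\bar y)$ and an update term $t^f_\delta(u,v;\bar y)$ over $\tau$, with $\bar y$ of the arity of $R$, respectively of $f$; * an arbitrary initialization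 mapping, which assigns to each graph on a finite non-empty domain $D$ an interpretation of $\tau_{\mathrm{aux}}$ over $D$; * a designated $0$-ary query symbol $Q\in\tau_{\mathrm{aux}}$. When the modification $\delta(a,b)$ (insertion of $(a,b)$ into $E$, or its deletion from $E$, with $a,b\in D$) is applied to a state $\mathcal S$ (a graph on $D$ together with an interpretation of $\tau_{\mathrm{aux}}$ over $D$), the graph is modified accordingly, and simultaneously each $R$ becomes $\{\bar c \mid \mathcal S\models\phi^R_\delta(a,b;\bar c)\}$ and each $f$ becomes the function $\bar c\mapsto t^f_\delta(a,b;\bar c)$ evaluated in $\mathcal S$. The program *maintains a Boolean query under insertions* if, for every graph $G$ on a finite non-empty domain and every finite (possibly empty) sequence of edge insertions, starting from $G$ with its initial auxiliary data and applying the sequence leads to a state in which $Q$ is true if and only if the query holds in the resulting graph. **Theorem.** For every $k\ge 1$, no quantifier-free dynamic program whose auxiliary relation symbols all have arity at most $k$ and whose auxiliary function symbols all have arity at most $1$ (that is, unary functions and constants) maintains $(k+2)$-Clique under insertions. -/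

import Mathlib

namespace DynQF

/- Schemas are first-order languages (`FirstOrder.Language`; a constant symbol is a function symbol
of arity `0`), and a database of schema `L` with domain `D` is an `L.Structure D`. -/

mutual

/-- Update terms over the schema `L` with variables from `α`: variables, applications of function
symbols, and the if-then-else construct, whose condition is a quantifier-free formula. -/
inductive UTerm (L : FirstOrder.Language.{0, 0}) (α : Type) : Type
  | var : α → UTerm L α
  | func : {n : ℕ} → L.Functions n → (Fin n → UTerm L α) → UTerm L α
  | ite : QFFormula L α → UTerm L α → UTerm L α → UTerm L α

/-- Quantifier-free first-order formulas over the schema `L` with free variables from `α`, built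
over update terms. The Boolean connectives are generated by falsum and implication. -/
inductive QFFormula (L : FirstOrder.Language.{0, 0}) (α : Type) : Type
  | falsum : QFFormula L α
  | equal : UTerm L α → UTerm L α → QFFormula L α
  | rel : {n : ℕ} → L.Relations n → (Fin n → UTerm L α) → QFFormula L α
  | imp : QFFormula L α → QFFormula L α → QFFormula L α

end

section Semantics

variable {L : FirstOrder.Language.{0, 0}} {α D : Type}

mutual

/-- The value of an update term in a structure under an assignment of the variables. -/
noncomputable def UTerm.eval [L.Structure D] (v : α → D) : UTerm L α → D
  | .var a => v a
  | .func f ts => FirstOrder.Language.Structure.funMap f (fun i => UTerm.eval v (ts i))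
  | .ite φ s t =>
      open Classical in if QFFormula.Holds v φ then UTerm.eval v s else UTerm.eval v t

/-- Satisfaction of a quantifier-free formula in a structure under an assignment. -/
noncomputable def QFFormula.Holds [L.Structure D] (v : α → D) : QFFormula L α → Prop
  | .falsum => False
  | .equal s t => UTerm.eval v s = UTerm.eval v t
  | .rel R ts => FirstOrder.Language.Structure.RelMap R (fun i => UTerm.eval v (ts i))
  | .imp φ ψ => QFFormula.Holds v φ → QFFormula.Holds v ψ

end

end Semantics

/-- The two kinds of modifications: insertion and deletion of a tuple. -/
inductive Op : Type
  | ins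
  | del

/-- A modification of a database of schema `τ` over `D`: the insertion of a tuple into, or the
deletion of a tuple from, one of the relations. -/
structure Modification (τ : FirstOrder.Language.{0, 0}) (D : Type) where
  op : Op
  arity : ℕ
  symb : τ.Relations arity
  tuple : Fin arity → D

/-- The atomic fact "`x` belongs to `R`" is the one addressed by the modification `m`. -/
def Modification.Addresses {τ : FirstOrder.Language.{0, 0}} {D : Type} (m : Modification τ D)
    {n : ℕ} (R : τ.Relations n) (x : Fin n → D) : Prop :=
  (⟨n, R, x⟩ : Σ n : ℕ, τ.Relations n × (Fin n → D)) = ⟨m.arity, m.symb, m.tuple⟩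

/-- The database resulting from applying a modification to a database. -/
abbrev Modification.apply {τ : FirstOrder.Language.{0, 0}} {D : Type} (m : Modification τ D)
    (I : τ.Structure D) : τ.Structure D where
  funMap := I.funMap
  RelMap := fun R x =>
    match m.op with
    | .ins => I.RelMap R x ∨ m.Addresses R x
    | .del => I.RelMap R x ∧ ¬ m.Addresses R x

/-- The database resulting from applying a sequence of modifications, first entry first. -/
abbrev applySeq {τ : FirstOrder.Language.{0, 0}} {D : Type} (μ : List (Modification τ D))
    (I : τ.Structure D) : τ.Structure D :=
  μ.foldl (fun J m => m.apply J) I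

/-- A quantifier-free update program over the dynamic schema `(τin, τaux)`. For every operation
on an input relation `S` it has, for every auxiliary relation symbol `R`, a quantifier-free update
formula, and, for every auxiliary function symbol `f`, an update term, over `τin ∪ τaux`. The
variables `Sum.inl i` stand for the modified tuple, the variables `Sum.inr j` for the updated
auxiliary tuple (respectively, for the argument of the function). -/
structure UpdateProgram (τin τaux : FirstOrder.Language.{0, 0}) where
  formula : Op → {m : ℕ} → τin.Relations m → {n : ℕ} → τaux.Relations n →
    QFFormula (τin.sum τaux) (Fin m ⊕ Fin n)
  term : Op → {m : ℕ} → τin.Relations m → {n : ℕ} → τaux.Functions n →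
    UTerm (τin.sum τaux) (Fin m ⊕ Fin n)

/-- A program state with domain `D`: the current input database and the auxiliary database. -/
structure State (τin τaux : FirstOrder.Language.{0, 0}) (D : Type) where
  input : τin.Structure D
  aux : τaux.Structure D

/-- A state, viewed as a structure over the schema `τin ∪ τaux`. -/
abbrev State.toStructure {τin τaux : FirstOrder.Language.{0, 0}} {D : Type} (S : State τin τaux D) :
    (τin.sum τaux).Structure D :=
  @FirstOrder.Language.sumStructure τin τaux D S.input S.aux

/-- The state resulting from one modification: the input database is modified, and all auxiliary
relations and functions are redefined simultaneously by evaluating the update formulas and update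
terms in the old state. -/
noncomputable def UpdateProgram.step {τin τaux : FirstOrder.Language.{0, 0}} {D : Type}
    (P : UpdateProgram τin τaux) (S : State τin τaux D) (m : Modification τin D) :
    State τin τaux D where
  input := m.apply S.input
  aux :=
    { funMap := fun f b =>
        @UTerm.eval _ _ _ S.toStructure (Sum.elim m.tuple b) (P.term m.op m.symb f)
      RelMap := fun R b =>
        @QFFormula.Holds _ _ _ S.toStructure (Sum.elim m.tuple b) (P.formula m.op m.symb R) }

/-- The state resulting from a sequence of modifications, first entry first. -/
noncomputable def UpdateProgram.run {τin τaux : FirstOrder.Language.{0, 0}} {D : Type}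
    (P : UpdateProgram τin τaux) (S : State τin τaux D) (μ : List (Modification τin D)) :
    State τin τaux D :=
  μ.foldl P.step S

/-- A quantifier-free dynamic program with an `r`-ary query symbol: an update program, an arbitrary
initialization mapping, and a designated auxiliary relation symbol. Domains are finite and
non-empty. -/
structure DynProgram (τin τaux : FirstOrder.Language.{0, 0}) (r : ℕ) where
  update : UpdateProgram τin τaux
  init : (D : Type) → [Finite D] → [Nonempty D] → τin.Structure D → τaux.Structure D
  query : τaux.Relations r

/-- An `r`-ary query on databases of schema `τ`. -/
abbrev Query (τ : FirstOrder.Language.{0, 0}) (r : ℕ) : Type 1 :=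
  (D : Type) → τ.Structure D → (Fin r → D) → Prop

/-- The program maintains the query `q` under insertions: for every initial input database and
every (possibly empty) sequence of insertions, the query relation of the state reached from the
initial state is the result of `q` on the modified database. -/
def DynProgram.MaintainsUnderInsertions {τin τaux : FirstOrder.Language.{0, 0}} {r : ℕ}
    (P : DynProgram τin τaux r) (q : Query τin r) : Prop :=
  ∀ (D : Type) [Finite D] [Nonempty D] (I : τin.Structure D) (μ : List (Modification τin D)),
    (∀ m ∈ μ, m.op = Op.ins) →
      ∀ b : Fin r → D,
        (P.update.run ⟨I, P.init D I⟩ μ).aux.RelMap P.query b ↔ q D (applySeq μ I) b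

/-- All relation symbols of the schema have arity at most `k`. -/
def RelArityLE (τ : FirstOrder.Language.{0, 0}) (k : ℕ) : Prop :=
  ∀ n : ℕ, k < n → IsEmpty (τ.Relations n)

/-- All function symbols of the schema have arity at most `k`. -/
def FunArityLE (τ : FirstOrder.Language.{0, 0}) (k : ℕ) : Prop :=
  ∀ n : ℕ, k < n → IsEmpty (τ.Functions n)

/-- The edge relation of a directed graph (loops allowed), i.e. of a database over the schema with
one binary relation symbol. -/
def Edge {D : Type} (G : FirstOrder.Language.graph.Structure D) (a b : D) : Prop :=
  G.RelMap FirstOrder.Language.adj ![a, b]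

/-- The Boolean `s`-clique query on directed graphs: there are `s` distinct nodes, any two of which
are joined by an edge in at least one direction. -/
def cliqueQuery (s : ℕ) : Query FirstOrder.Language.graph 0 :=
  fun D G _ => ∃ v : Fin s → D, Function.Injective v ∧
    ∀ i j : Fin s, i ≠ j → Edge G (v i) (v j) ∨ Edge G (v j) (v i)

end DynQF

-- The proof is a counting argument. Take `k + 1` groups of `n` nodes and one further node for each
-- choice of a node from every group; for a set `H` of choices, join each `c ∈ H` to its chosen
-- nodes. Inserting all edges among the nodes chosen by `s` creates a `(k + 2)`-clique iff `s ∈ H`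
-- (`cliqueQuery_insert_groupPairs`).
--
-- The pattern of insertions is fixed, so the query after it is expressed by one quantifier-free
-- formula over the initial state, in `k + 1` variables and independent of `n` and `H`
-- (`UpdateProgram.exists_pullback`). Its truth value depends on finitely many terms without
-- if-then-else and finitely many atoms over them (`QFFormula.exists_flat`).
--
-- With functions at most unary, such a term depends on one variable
-- (`UTerm.IsPure.exists_dependsOn`), so it contributes `n` values, each one of polynomially many
-- nodes. An auxiliary atom has at most `k` arguments, so it misses a variable and contributes `n ^
-- k` bits. Altogether there are fewer than `2 ^ n ^ (k + 1)` possibilities (`exists_card_lt`), so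
-- two sets `H ≠ H'` look alike (`FinitePure.exists_agree`), although the formula must tell them
-- apart.

namespace DynQF

open FirstOrder

-- Substitution into update terms and formulas.

section Substitution

variable {L : FirstOrder.Language.{0, 0}} {α β D : Type}

mutual

/-- Substitution of terms for the variables of an update term. -/
def UTerm.subst (σ : α → UTerm L β) : UTerm L α → UTerm L β
  | .var a => σ a
  | .func f ts => .func f (fun i => UTerm.subst σ (ts i))
  | .ite φ s t => .ite (QFFormula.subst σ φ) (UTerm.subst σ s) (UTerm.subst σ t)

/-- Substitution of terms for the variables of a quantifier-free formula. -/
def QFFormula.subst (σ : α → UTerm L β) : QFFormula L α → QFFormula L β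
  | .falsum => .falsum
  | .equal s t => .equal (UTerm.subst σ s) (UTerm.subst σ t)
  | .rel R ts => .rel R (fun i => UTerm.subst σ (ts i))
  | .imp φ ψ => .imp (QFFormula.subst σ φ) (QFFormula.subst σ ψ)

end

mutual

theorem UTerm.eval_subst [L.Structure D] (σ : α → UTerm L β) (v : β → D) :
    ∀ t : UTerm L α, (t.subst σ).eval v = t.eval (fun a => (σ a).eval v)
  | .var a => by simp only [UTerm.subst, UTerm.eval]
  | .func f ts => by
      simp only [UTerm.subst, UTerm.eval]
      exact congrArg _ (funext fun i => UTerm.eval_subst σ v (ts i))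
  | .ite φ s t => by
      classical
      simp only [UTerm.subst, UTerm.eval]
      exact if_congr (QFFormula.holds_subst σ v φ) (UTerm.eval_subst σ v s)
        (UTerm.eval_subst σ v t)

theorem QFFormula.holds_subst [L.Structure D] (σ : α → UTerm L β) (v : β → D) :
    ∀ φ : QFFormula L α, (φ.subst σ).Holds v ↔ φ.Holds (fun a => (σ a).eval v)
  | .falsum => by simp only [QFFormula.subst, QFFormula.Holds]
  | .equal s t => by
      simp only [QFFormula.subst, QFFormula.Holds, UTerm.eval_subst σ v s, UTerm.eval_subst σ v t]
  | .rel R ts => by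
      simp only [QFFormula.subst, QFFormula.Holds]
      exact iff_of_eq (congrArg _ (funext fun i => UTerm.eval_subst σ v (ts i)))
  | .imp φ ψ => by
      simp only [QFFormula.subst, QFFormula.Holds, QFFormula.holds_subst σ v φ,
        QFFormula.holds_subst σ v ψ]

end

end Substitution

-- Expressing the state after insertions over the state before them.

section Pullback

variable {τ : FirstOrder.Language.{0, 0}} {α D : Type}

/-- The insertion of the edge whose endpoints are the values of the variables `e 0` and `e 1`. -/
def insertEdge (v : α → D) (e : Fin 2 → α) : Modification Language.graph D :=
  ⟨.ins, 2, Language.adj, v ∘ e⟩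

/-- The term over the old state which gives the value of a function symbol in the state after the
insertion of `e`. -/
def UpdateProgram.pullFun (P : UpdateProgram Language.graph τ) (e : Fin 2 → α) {n : ℕ}
    (f : (Language.graph.sum τ).Functions n) (ts : Fin n → UTerm (Language.graph.sum τ) α) :
    UTerm (Language.graph.sum τ) α :=
  match f with
  | .inl f => .func (.inl f) ts
  | .inr f => (P.term .ins Language.adj f).subst (Sum.elim (fun i => .var (e i)) ts)

/-- The formula over the old state which expresses an atom in the state after the insertion
of `e`. -/
def UpdateProgram.pullRel (P : UpdateProgram Language.graph τ) (e : Fin 2 → α) {n : ℕ}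
    (R : (Language.graph.sum τ).Relations n) (ts : Fin n → UTerm (Language.graph.sum τ) α) :
    QFFormula (Language.graph.sum τ) α :=
  match n, R, ts with
  | _, .inl .adj, ts =>
      -- With only implication and falsum available, this encodes "the inserted edge, or an old
      -- edge".
      .imp (.imp (.equal (ts 0) (.var (e 0)))
        (.imp (.equal (ts 1) (.var (e 1))) .falsum)) (.rel (.inl .adj) ts)
  | _, .inr R, ts =>
      (P.formula .ins Language.adj R).subst (Sum.elim (fun i => .var (e i)) ts)

mutual

/-- The term over the old state whose value is that of the given term in the state after the
insertion of `e`. -/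
def UpdateProgram.pullTerm (P : UpdateProgram Language.graph τ) (e : Fin 2 → α) :
    UTerm (Language.graph.sum τ) α → UTerm (Language.graph.sum τ) α
  | .var a => .var a
  | .func f ts => P.pullFun e f (fun i => UpdateProgram.pullTerm P e (ts i))
  | .ite φ s t => .ite (UpdateProgram.pullFormula P e φ) (UpdateProgram.pullTerm P e s)
      (UpdateProgram.pullTerm P e t)

/-- The formula over the old state which expresses the given formula in the state after the
insertion of `e`. -/
def UpdateProgram.pullFormula (P : UpdateProgram Language.graph τ) (e : Fin 2 → α) :
    QFFormula (Language.graph.sum τ) α → QFFormula (Language.graph.sum τ) α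
  | .falsum => .falsum
  | .equal s t => .equal (UpdateProgram.pullTerm P e s) (UpdateProgram.pullTerm P e t)
  | .rel R ts => P.pullRel e R (fun i => UpdateProgram.pullTerm P e (ts i))
  | .imp φ ψ => .imp (UpdateProgram.pullFormula P e φ) (UpdateProgram.pullFormula P e ψ)

end

/-- The value of a term in a state. -/
noncomputable abbrev State.eval (S : State Language.graph τ D) (v : α → D)
    (t : UTerm (Language.graph.sum τ) α) : D :=
  @UTerm.eval _ _ _ S.toStructure v t

/-- Satisfaction of a formula in a state. -/
abbrev State.Holds (S : State Language.graph τ D) (v : α → D)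
    (φ : QFFormula (Language.graph.sum τ) α) : Prop :=
  @QFFormula.Holds _ _ _ S.toStructure v φ

theorem insertEdge_addresses (v : α → D) (e : Fin 2 → α) (x : Fin 2 → D) :
    (insertEdge v e).Addresses Language.adj x ↔ x 0 = v (e 0) ∧ x 1 = v (e 1) := by
  unfold Modification.Addresses insertEdge
  constructor
  · intro h
    simp only [Sigma.mk.injEq, heq_eq_eq, true_and, Prod.mk.injEq] at h
    simp [h]
  · rintro ⟨h0, h1⟩
    have : x = v ∘ e := by
      funext i; fin_cases i
      · exact h0
      · exact h1
    rw [this]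

theorem sum_elim_eval [(Language.graph.sum τ).Structure D] (v : α → D) (e : Fin 2 → α) {n : ℕ}
    (ts : Fin n → UTerm (Language.graph.sum τ) α) :
    (fun a => (Sum.elim (fun i => UTerm.var (e i)) ts a).eval v) =
      Sum.elim (v ∘ e) (fun i => (ts i).eval v) := by
  funext a
  rcases a with a | a
  · simp [UTerm.eval]
  · simp

theorem UpdateProgram.eval_pullFun (P : UpdateProgram Language.graph τ) (e : Fin 2 → α)
    (S : State Language.graph τ D) (v : α → D) {n : ℕ}
    (f : (Language.graph.sum τ).Functions n) (ts : Fin n → UTerm (Language.graph.sum τ) α) :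
    S.eval v (P.pullFun e f ts) =
      (P.step S (insertEdge v e)).toStructure.funMap f (fun i => S.eval v (ts i)) := by
  rcases f with f | f
  · exact f.elim
  · let := S.toStructure
    simp only [pullFun, State.eval, UTerm.eval_subst, sum_elim_eval]
    rfl

theorem UpdateProgram.holds_pullRel (P : UpdateProgram Language.graph τ) (e : Fin 2 → α)
    (S : State Language.graph τ D) (v : α → D) {n : ℕ}
    (R : (Language.graph.sum τ).Relations n) (ts : Fin n → UTerm (Language.graph.sum τ) α) :
    S.Holds v (P.pullRel e R ts) ↔
      (P.step S (insertEdge v e)).toStructure.RelMap R (fun i => S.eval v (ts i)) := by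
  rcases R with R | R
  · cases R
    have : (P.step S (insertEdge v e)).toStructure.RelMap (.inl .adj) (fun i => S.eval v (ts i)) ↔
        S.toStructure.RelMap (.inl .adj) (fun i => S.eval v (ts i)) ∨
          (insertEdge v e).Addresses Language.adj (fun i => S.eval v (ts i)) := Iff.rfl
    rw [this, insertEdge_addresses]
    simp only [State.Holds, pullRel, QFFormula.Holds, UTerm.eval]
    tauto
  · let := S.toStructure
    simp only [pullRel, State.Holds, QFFormula.holds_subst, sum_elim_eval]
    rfl

mutual

theorem UpdateProgram.eval_pullTerm (P : UpdateProgram Language.graph τ) (e : Fin 2 → α)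
    (S : State Language.graph τ D) (v : α → D) :
    ∀ t, S.eval v (P.pullTerm e t) = (P.step S (insertEdge v e)).eval v t
  | .var a => by simp only [State.eval, pullTerm, UTerm.eval]
  | .func f ts => by
      rw [pullTerm, eval_pullFun]
      simp only [State.eval, UTerm.eval]
      exact congrArg _ (funext fun i => UpdateProgram.eval_pullTerm P e S v (ts i))
  | .ite φ s t => by
      classical
      simp only [State.eval, pullTerm, UTerm.eval]
      exact if_congr (UpdateProgram.holds_pullFormula P e S v φ)
        (UpdateProgram.eval_pullTerm P e S v s) (UpdateProgram.eval_pullTerm P e S v t)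

theorem UpdateProgram.holds_pullFormula (P : UpdateProgram Language.graph τ) (e : Fin 2 → α)
    (S : State Language.graph τ D) (v : α → D) :
    ∀ φ, S.Holds v (P.pullFormula e φ) ↔ (P.step S (insertEdge v e)).Holds v φ
  | .falsum => by simp only [State.Holds, pullFormula, QFFormula.Holds]
  | .equal s t => by
      have hs := UpdateProgram.eval_pullTerm P e S v s
      have ht := UpdateProgram.eval_pullTerm P e S v t
      simp only [State.eval] at hs ht
      simp only [State.Holds, pullFormula, QFFormula.Holds, hs, ht]
  | .rel R ts => by
      rw [pullFormula, holds_pullRel]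
      simp only [State.Holds, QFFormula.Holds]
      exact iff_of_eq (congrArg _ (funext fun i => UpdateProgram.eval_pullTerm P e S v (ts i)))
  | .imp φ ψ => by
      have h₁ := UpdateProgram.holds_pullFormula P e S v φ
      have h₂ := UpdateProgram.holds_pullFormula P e S v ψ
      simp only [State.Holds] at h₁ h₂
      simp only [State.Holds, pullFormula, QFFormula.Holds, h₁, h₂]

end

/-- A formula about the state after a fixed pattern of insertions is equivalent to a formula about
the original state. -/
theorem UpdateProgram.exists_pullback (P : UpdateProgram Language.graph τ)
    (φ : QFFormula (Language.graph.sum τ) α) (es : List (Fin 2 → α)) :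
    ∃ ψ : QFFormula (Language.graph.sum τ) α,
      ∀ (D : Type) (S : State Language.graph τ D) (v : α → D),
        (P.run S (es.map (insertEdge v))).Holds v φ ↔ S.Holds v ψ := by
  induction es with
  | nil => exact ⟨φ, fun D S v => Iff.rfl⟩
  | cons e es ih =>
    obtain ⟨ψ, hψ⟩ := ih
    -- `ψ` accounts for the later insertions, so it is read in the state after `e` and pulled back
    -- once more.
    refine ⟨P.pullFormula e ψ, fun D S v => ?_⟩
    rw [holds_pullFormula, ← hψ]
    rfl

theorem edge_applySeq_insertEdge (v : α → D) (es : List (Fin 2 → α))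
    (I : Language.graph.Structure D) (a b : D) :
    Edge (applySeq (es.map (insertEdge v)) I) a b ↔
      Edge I a b ∨ ∃ e ∈ es, a = v (e 0) ∧ b = v (e 1) := by
  induction es generalizing I with
  | nil => simp [applySeq]
  | cons e es ih =>
    have h : Edge ((insertEdge v e).apply I) a b ↔ Edge I a b ∨ (a = v (e 0) ∧ b = v (e 1)) := by
      have := insertEdge_addresses v e ![a, b]
      simp only [Matrix.cons_val_zero, Matrix.cons_val_one] at this
      rw [← this]
      rfl
    have h' : Edge (applySeq ((e :: es).map (insertEdge v)) I) a b ↔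
        Edge (applySeq (es.map (insertEdge v)) ((insertEdge v e).apply I)) a b := Iff.rfl
    rw [h', ih, h]
    simp [or_assoc]

end Pullback

-- Elimination of if-then-else.

section Flattening

variable {L : FirstOrder.Language.{0, 0}} {α D : Type}

/-- Terms without if-then-else. -/
inductive UTerm.IsPure : UTerm L α → Prop
  | var (a : α) : IsPure (.var a)
  | func {n : ℕ} (f : L.Functions n) (ts : Fin n → UTerm L α) :
      (∀ i, IsPure (ts i)) → IsPure (.func f ts)

/-- Relational atoms over the schema `L`. -/
abbrev Atom (L : FirstOrder.Language.{0, 0}) (α : Type) : Type :=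
  Σ n : ℕ, L.Relations n × (Fin n → UTerm L α)

/-- Satisfaction of an atom. -/
abbrev Atom.Holds (I : L.Structure D) (v : α → D) (b : Atom L α) : Prop :=
  I.RelMap b.2.1 (fun i => (b.2.2 i).eval v)

/-- Two structures give the same values to the terms in `T` and the atoms in `B`. -/
def Agree (T : Set (UTerm L α)) (B : Set (Atom L α)) (I J : L.Structure D) (v : α → D) : Prop :=
  (∀ p ∈ T, @UTerm.eval _ _ _ I v p = @UTerm.eval _ _ _ J v p) ∧
    ∀ b ∈ B, b.Holds I v ↔ b.Holds J v

theorem Agree.mono {T T' : Set (UTerm L α)} {B B' : Set (Atom L α)} {I J : L.Structure D}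
    {v : α → D} (h : Agree T' B' I J v) (hT : T ⊆ T') (hB : B ⊆ B') : Agree T B I J v :=
  ⟨fun p hp => h.1 p (hT hp), fun b hb => h.2 b (hB hb)⟩

/-- Finitely many terms without if-then-else and finitely many atoms over such terms. -/
structure FinitePure (T : Set (UTerm L α)) (B : Set (Atom L α)) : Prop where
  finite_terms : T.Finite
  finite_atoms : B.Finite
  pure_terms : ∀ p ∈ T, p.IsPure
  atom_terms : ∀ b ∈ B, ∀ i, b.2.2 i ∈ T

theorem FinitePure.union {T T' : Set (UTerm L α)} {B B' : Set (Atom L α)}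
    (h : FinitePure T B) (h' : FinitePure T' B') : FinitePure (T ∪ T') (B ∪ B') where
  finite_terms := h.1.union h'.1
  finite_atoms := h.2.union h'.2
  pure_terms := by rintro p (hp | hp); exacts [h.3 p hp, h'.3 p hp]
  atom_terms := by
    rintro b (hb | hb) i
    exacts [Or.inl (h.4 b hb i), Or.inr (h'.4 b hb i)]

theorem FinitePure.iUnion {ι : Type} [Finite ι] {T : ι → Set (UTerm L α)}
    {B : ι → Set (Atom L α)} (h : ∀ i, FinitePure (T i) (B i)) :
    FinitePure (⋃ i, T i) (⋃ i, B i) where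
  finite_terms := Set.finite_iUnion fun i => (h i).1
  finite_atoms := Set.finite_iUnion fun i => (h i).2
  pure_terms := by
    intro p hp
    obtain ⟨i, hi⟩ := Set.mem_iUnion.1 hp
    exact (h i).3 p hi
  atom_terms := by
    intro b hb j
    obtain ⟨i, hi⟩ := Set.mem_iUnion.1 hb
    exact Set.mem_iUnion.2 ⟨i, (h i).4 b hi j⟩

mutual

/-- The value of a term is always that of one of finitely many terms without if-then-else, and
which one it is depends only on finitely many atoms. -/
theorem UTerm.exists_flat : ∀ t : UTerm L α, ∃ (T : Set (UTerm L α)) (B : Set (Atom L α)),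
    FinitePure T B ∧ ∀ (D : Type) (I J : L.Structure D) (v : α → D), Agree T B I J v →
      ∃ p ∈ T, @UTerm.eval _ _ _ I v t = @UTerm.eval _ _ _ I v p ∧
        @UTerm.eval _ _ _ J v t = @UTerm.eval _ _ _ J v p
  | .var a => ⟨{.var a}, ∅, ⟨Set.finite_singleton _, Set.finite_empty,
      by rintro p rfl; exact .var a, by simp⟩, fun D I J v _ => ⟨.var a, rfl, rfl, rfl⟩⟩
  | .func f ts => by
      choose T B hTB hT using fun i => UTerm.exists_flat (ts i)
      have hF := FinitePure.iUnion hTB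
      -- The argument terms are kept, since conditions nested inside the arguments may depend on
      -- their values.
      refine ⟨(⋃ i, T i) ∪ UTerm.func f '' Set.pi Set.univ T, ⋃ i, B i,
        ⟨hF.1.union ((Set.Finite.pi' fun i => (hTB i).1).subset ?_ |>.image _), hF.2, ?_, ?_⟩, ?_⟩
      · intro g hg i
        exact hg i trivial
      · rintro p (hp | ⟨g, hg, rfl⟩)
        · exact hF.3 p hp
        · exact .func f g fun i => (hTB i).3 _ (hg i trivial)
      · exact fun b hb i => Or.inl (hF.4 b hb i)
      · intro D I J v hA
        choose p hp hI hJ using fun i => hT i D I J v (hA.mono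
          ((Set.subset_iUnion T i).trans Set.subset_union_left) (Set.subset_iUnion B i))
        refine ⟨.func f p, Or.inr ⟨p, fun i _ => hp i, rfl⟩, ?_, ?_⟩
        · simp only [UTerm.eval, hI]
        · simp only [UTerm.eval, hJ]
  | .ite φ s t => by
      obtain ⟨T₁, B₁, h₁, H₁⟩ := QFFormula.exists_flat φ
      obtain ⟨T₂, B₂, h₂, H₂⟩ := UTerm.exists_flat s
      obtain ⟨T₃, B₃, h₃, H₃⟩ := UTerm.exists_flat t
      refine ⟨T₁ ∪ (T₂ ∪ T₃), B₁ ∪ (B₂ ∪ B₃), h₁.union (h₂.union h₃), fun D I J v hA => ?_⟩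
      -- The condition has the same truth value in both structures, so both select the same branch.
      have e₁ := H₁ D I J v (hA.mono (by grind) (by grind))
      obtain ⟨p, hp, hpI, hpJ⟩ := H₂ D I J v (hA.mono (by grind) (by grind))
      obtain ⟨q, hq, hqI, hqJ⟩ := H₃ D I J v (hA.mono (by grind) (by grind))
      by_cases h : @QFFormula.Holds _ _ _ I v φ
      · have h' := e₁.1 h
        exact ⟨p, by grind, by simp only [UTerm.eval]; exact (if_pos h).trans hpI,
          by simp only [UTerm.eval]; exact (if_pos h').trans hpJ⟩
      · have h' := fun x => h (e₁.2 x)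
        exact ⟨q, by grind, by simp only [UTerm.eval]; exact (if_neg h).trans hqI,
          by simp only [UTerm.eval]; exact (if_neg h').trans hqJ⟩

/-- The truth value of a quantifier-free formula depends only on the values of finitely many terms
without if-then-else and the truth values of finitely many atoms over these. -/
theorem QFFormula.exists_flat : ∀ φ : QFFormula L α,
    ∃ (T : Set (UTerm L α)) (B : Set (Atom L α)),
    FinitePure T B ∧ ∀ (D : Type) (I J : L.Structure D) (v : α → D), Agree T B I J v →
      (@QFFormula.Holds _ _ _ I v φ ↔ @QFFormula.Holds _ _ _ J v φ)
  | .falsum => ⟨∅, ∅, ⟨Set.finite_empty, Set.finite_empty, by simp, by simp⟩,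
      fun D I J v _ => by simp only [QFFormula.Holds]⟩
  | .equal s t => by
      obtain ⟨T₁, B₁, h₁, H₁⟩ := UTerm.exists_flat s
      obtain ⟨T₂, B₂, h₂, H₂⟩ := UTerm.exists_flat t
      refine ⟨T₁ ∪ T₂, B₁ ∪ B₂, h₁.union h₂, fun D I J v hA => ?_⟩
      obtain ⟨p, hp, hpI, hpJ⟩ := H₁ D I J v (hA.mono (by grind) (by grind))
      obtain ⟨q, hq, hqI, hqJ⟩ := H₂ D I J v (hA.mono (by grind) (by grind))
      simp only [QFFormula.Holds]
      rw [hpI, hpJ, hqI, hqJ, hA.1 p (Or.inl hp), hA.1 q (Or.inr hq)]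
  | .rel (n := n) R ts => by
      choose T B hTB hT using fun i => UTerm.exists_flat (ts i)
      have hF := FinitePure.iUnion hTB
      refine ⟨⋃ i, T i, (⋃ i, B i) ∪ (fun g => ⟨n, R, g⟩) '' Set.pi Set.univ T,
        ⟨hF.1, hF.2.union ((Set.Finite.pi' fun i => (hTB i).1).subset ?_ |>.image _), hF.3, ?_⟩,
        ?_⟩
      · intro g hg i
        exact hg i trivial
      · rintro b (hb | ⟨g, hg, rfl⟩) i
        · exact hF.4 b hb i
        · exact Set.mem_iUnion.2 ⟨i, hg i trivial⟩
      · intro D I J v hA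
        choose p hp hI hJ using fun i => hT i D I J v (hA.mono (Set.subset_iUnion T i)
          ((Set.subset_iUnion B i).trans Set.subset_union_left))
        simp only [QFFormula.Holds, hI, hJ]
        exact hA.2 ⟨n, R, p⟩ (Or.inr ⟨p, fun i _ => hp i, rfl⟩)
  | .imp φ ψ => by
      obtain ⟨T₁, B₁, h₁, H₁⟩ := QFFormula.exists_flat φ
      obtain ⟨T₂, B₂, h₂, H₂⟩ := QFFormula.exists_flat ψ
      refine ⟨T₁ ∪ T₂, B₁ ∪ B₂, h₁.union h₂, fun D I J v hA => ?_⟩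
      have e₁ := H₁ D I J v (hA.mono (by grind) (by grind))
      have e₂ := H₂ D I J v (hA.mono (by grind) (by grind))
      simp only [QFFormula.Holds, e₁, e₂]

end

/-- If all function symbols are at most unary, a term without if-then-else depends on at most one
variable. -/
theorem UTerm.IsPure.exists_dependsOn [Nonempty α] (hL : FunArityLE L 1) {p : UTerm L α}
    (hp : p.IsPure) : ∃ a : α, ∀ (D : Type) (I : L.Structure D) (v w : α → D), v a = w a →
      @UTerm.eval _ _ _ I v p = @UTerm.eval _ _ _ I w p := by
  induction hp with
  | var a => exact ⟨a, fun D I v w h => by simpa only [UTerm.eval] using h⟩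
  | @func n f ts _ ih =>
    rcases Nat.lt_or_ge 1 n with hn | hn
    · exact ((hL n hn).false f).elim
    · rcases Nat.eq_zero_or_pos n with rfl | hn'
      -- A constant depends on no variable, so any one serves.
      · refine ⟨Classical.arbitrary α, fun D I v w _ => ?_⟩
        simp only [UTerm.eval]
        exact congrArg _ (funext fun i => i.elim0)
      · obtain rfl : n = 1 := by omega
        obtain ⟨a, ha⟩ := ih 0
        refine ⟨a, fun D I v w h => ?_⟩
        simp only [UTerm.eval]
        refine congrArg _ (funext fun i => ?_)
        rw [Subsingleton.elim i 0]
        exact ha D I v w h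

end Flattening

-- Graphs that encode sets of choices.

section LowerBound

/-- The domain with `k + 1` groups of `n` nodes and one node for every choice of a node from each
group. -/
abbrev CliqueDomain (k n : ℕ) : Type := (Fin (k + 1) × Fin n) ⊕ (Fin (k + 1) → Fin n)

variable {k n : ℕ}

/-- The node standing for a choice `c ∈ H` is joined to the chosen nodes. -/
def cliqueEdge (H : Set (Fin (k + 1) → Fin n)) : CliqueDomain k n → CliqueDomain k n → Prop
  | .inr c, .inl (i, x) => c ∈ H ∧ c i = x
  | _, _ => False

/-- The directed graph with edge relation `cliqueEdge H`. -/
abbrev cliqueGraph (H : Set (Fin (k + 1) → Fin n)) :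
    Language.graph.Structure (CliqueDomain k n) where
  funMap := fun f _ => f.elim
  RelMap | .adj => fun x => cliqueEdge H (x 0) (x 1)

/-- The nodes of a choice, one from each group. -/
def choiceNodes (s : Fin (k + 1) → Fin n) (i : Fin (k + 1)) : CliqueDomain k n := .inl (i, s i)

/-- All pairs of indices of groups. -/
noncomputable def groupPairs (k : ℕ) : List (Fin 2 → Fin (k + 1)) := Finset.univ.toList

/-- The membership in `H` of the choice for which a node stands. -/
def marked (H : Set (Fin (k + 1) → Fin n)) : CliqueDomain k n → Prop
  | .inl _ => False
  | .inr c => c ∈ H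

/-- `H` influences the edges leaving `x` only through one bit at `x`. Hence edge atoms between term
values need one extra bit per value rather than one per pair, which matters when `k = 1` and the
edge relation has arity above `k`. -/
theorem cliqueEdge_congr {H H' : Set (Fin (k + 1) → Fin n)} {x : CliqueDomain k n}
    (h : marked H x = marked H' x) (y : CliqueDomain k n) :
    cliqueEdge H x y ↔ cliqueEdge H' x y := by
  rcases x with x | c <;> rcases y with y | c' <;> simp_all [cliqueEdge, marked]

theorem edge_insert_groupPairs (H : Set (Fin (k + 1) → Fin n)) (s : Fin (k + 1) → Fin n)
    (x y : CliqueDomain k n) :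
    Edge (applySeq ((groupPairs k).map (insertEdge (choiceNodes s))) (cliqueGraph H)) x y ↔
      cliqueEdge H x y ∨ ∃ i j, x = choiceNodes s i ∧ y = choiceNodes s j := by
  rw [edge_applySeq_insertEdge]
  refine or_congr Iff.rfl ⟨?_, ?_⟩
  · rintro ⟨e, -, h⟩
    exact ⟨_, _, h⟩
  · rintro ⟨i, j, h⟩
    exact ⟨![i, j], by simp [groupPairs], by simpa using h⟩

/-- Choice nodes are pairwise non-adjacent, so a clique contains at most one. Without any, all `k +
2` members would lie among the `k + 1` nodes chosen by `s`. With one, `c`, the others are neighbours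
of `c` in distinct groups, hence one from each; their mutual adjacency comes only from the
insertions, so `c = s`. -/
theorem cliqueQuery_insert_groupPairs (hk : 1 ≤ k) (H : Set (Fin (k + 1) → Fin n))
    (s : Fin (k + 1) → Fin n) (b : Fin 0 → CliqueDomain k n) :
    cliqueQuery (k + 2) (CliqueDomain k n)
      (applySeq ((groupPairs k).map (insertEdge (choiceNodes s))) (cliqueGraph H)) b ↔ s ∈ H := by
  simp only [cliqueQuery, edge_insert_groupPairs]
  constructor
  · rintro ⟨v, hv, hE⟩
    have hinl : ∀ m m' : Fin (k + 2), m ≠ m' → ∀ p p', v m = .inl p → v m' = .inl p' →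
        ∃ i, v m = choiceNodes s i := by
      intro m m' hm p p' hp hp'
      have := hE m m' hm
      rw [hp, hp'] at this
      simp only [cliqueEdge, false_or] at this
      rw [hp]
      rcases this with ⟨i, j, h, -⟩ | ⟨i, j, -, h⟩
      exacts [⟨i, h⟩, ⟨j, h⟩]
    by_cases hc : ∃ m c, v m = .inr c
    · obtain ⟨m₀, c, hc⟩ := hc
      have hw : ∀ m : Fin (k + 1), ∃ i, c ∈ H ∧ v (m₀.succAbove m) = .inl (i, c i) := by
        intro m
        have := hE m₀ (m₀.succAbove m) (Fin.succAbove_ne m₀ m).symm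
        rw [hc] at this
        rcases hx : v (m₀.succAbove m) with ⟨i, x⟩ | c' <;> rw [hx] at this
        · simp [cliqueEdge, choiceNodes] at this
          exact ⟨i, this.1, by rw [this.2]⟩
        · simp [cliqueEdge, choiceNodes] at this
      choose w hcH hw using hw
      have hinj : Function.Injective w := by
        intro m m' h
        apply Fin.succAbove_right_injective (p := m₀)
        apply hv
        rw [hw, hw, h]
      have hsurj := Finite.injective_iff_surjective.1 hinj
      have : c = s := by
        funext i
        obtain ⟨m, rfl⟩ := hsurj i
        -- Here `1 ≤ k` matters: a clique member in a second group forces the inserted edge that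
        -- ties the node to `s`.
        have : Nontrivial (Fin (k + 1)) := Fin.nontrivial_iff_two_le.2 (by omega)
        obtain ⟨m', hm'⟩ := exists_ne m
        obtain ⟨j, hj⟩ := hinl _ _ (fun h => hm' (Fin.succAbove_right_injective h).symm) _ _
          (hw m) (hw m')
        rw [hw m, choiceNodes] at hj
        simp only [Sum.inl.injEq, Prod.mk.injEq] at hj
        rw [hj.2, hj.1]
      exact this ▸ hcH 0
    · have hl : ∀ m, ∃ p, v m = .inl p := by
        intro m
        rcases hx : v m with p | c
        · exact ⟨p, rfl⟩
        · exact (hc ⟨m, c, hx⟩).elim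
      choose p hp using hl
      have hi : ∀ m, ∃ i, v m = choiceNodes s i := by
        intro m
        obtain ⟨m', hm'⟩ := exists_ne m
        exact hinl m m' hm'.symm _ _ (hp m) (hp m')
      choose w hw using hi
      have hinj : Function.Injective w := fun m m' h => hv (by rw [hw, hw, h])
      have := Fintype.card_le_of_injective w hinj
      simp at this
  · intro hs
    refine ⟨Fin.cons (.inr s) (choiceNodes s), ?_, ?_⟩
    · rw [Fin.cons_injective_iff]
      refine ⟨by simp [choiceNodes], fun i j h => ?_⟩
      simp only [choiceNodes, Sum.inl.injEq, Prod.mk.injEq] at h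
      exact h.1
    · intro i j
      refine Fin.cases ?_ (fun i => ?_) i <;> refine Fin.cases ?_ (fun j => ?_) j <;> intro hij
      · exact absurd rfl hij
      · exact Or.inl (Or.inl ⟨hs, rfl⟩)
      · exact Or.inr (Or.inl ⟨hs, rfl⟩)
      · exact Or.inl (Or.inr ⟨i, j, rfl, rfl⟩)

-- Counting.

theorem exists_mul_pow_lt_two_pow (C K : ℕ) : ∃ n : ℕ, 0 < n ∧ C * n ^ K < 2 ^ n := by
  have h := tendsto_pow_const_div_const_pow_of_one_lt K (one_lt_two (α := ℝ))
  have hC : (0 : ℝ) < 1 / (C + 1) := by positivity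
  obtain ⟨n, hn, hn0⟩ := ((h.eventually (gt_mem_nhds hC)).and
    (Filter.eventually_gt_atTop 0)).exists
  refine ⟨n, hn0, ?_⟩
  rw [div_lt_div_iff₀ (by positivity) (by positivity)] at hn
  have : (C : ℝ) * n ^ K < 2 ^ n := by
    have : (0 : ℝ) ≤ n ^ K := by positivity
    nlinarith
  exact_mod_cast this

/-- Here `t` counts terms and `b` atoms; the base is the number of nodes, doubled for a marking bit.
Since `n ≤ n ^ k`, both factors are bounded by `n ^ k`-th powers, which leaves a polynomial in `n`
to compare with `2 ^ n`. -/
theorem exists_card_lt (hk : 1 ≤ k) (t b : ℕ) : ∃ n : ℕ, 0 < n ∧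
    ((((k + 1) * n + n ^ (k + 1)) * 2) ^ (t * n)) * 2 ^ (b * n ^ k) < 2 ^ n ^ (k + 1) := by
  obtain ⟨n, hn, h⟩ := exists_mul_pow_lt_two_pow ((2 * (k + 2)) ^ t * 2 ^ b) ((k + 1) * t)
  refine ⟨n, hn, ?_⟩
  set X := ((k + 1) * n + n ^ (k + 1)) * 2 with hX
  have hX1 : 1 ≤ X := by
    have : 0 < n ^ (k + 1) := by positivity
    omega
  have hXn : X ≤ 2 * (k + 2) * n ^ (k + 1) := by
    have : n ≤ n ^ (k + 1) := Nat.le_self_pow (by omega) n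
    rw [hX]
    nlinarith
  have hlt : X ^ t * 2 ^ b < 2 ^ n := by
    refine lt_of_le_of_lt ?_ h
    calc X ^ t * 2 ^ b ≤ (2 * (k + 2) * n ^ (k + 1)) ^ t * 2 ^ b := by gcongr
      _ = _ := by rw [mul_pow _ (n ^ (k + 1)), ← pow_mul]; ring
  calc X ^ (t * n) * 2 ^ (b * n ^ k) ≤ X ^ (t * n ^ k) * 2 ^ (b * n ^ k) := by
        gcongr
        · exact Nat.le_self_pow (by omega) n
    _ = (X ^ t * 2 ^ b) ^ n ^ k := by rw [mul_pow (X ^ t), ← pow_mul, ← pow_mul]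
    _ < (2 ^ n) ^ n ^ k := Nat.pow_lt_pow_left hlt (by positivity)
    _ = 2 ^ n ^ (k + 1) := by rw [← pow_mul, pow_succ, mul_comm n]

/-- Over a schema with at most unary functions, the state on `cliqueGraph H` and auxiliary data of
arity at most `k` does not determine `H` through finitely many terms and atoms. -/
theorem FinitePure.exists_agree {τ : FirstOrder.Language.{0, 0}} (hk : 1 ≤ k)
    (hR : RelArityLE τ k) (hF : FunArityLE τ 1)
    {T : Set (UTerm (Language.graph.sum τ) (Fin (k + 1)))}
    {B : Set (Atom (Language.graph.sum τ) (Fin (k + 1)))} (hTB : FinitePure T B) :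
    ∃ n : ℕ, 0 < n ∧ ∀ aux : Set (Fin (k + 1) → Fin n) → τ.Structure (CliqueDomain k n),
      ∃ H H' : Set (Fin (k + 1) → Fin n), H ≠ H' ∧ ∀ s, Agree T B
        (State.toStructure ⟨cliqueGraph H, aux H⟩) (State.toStructure ⟨cliqueGraph H', aux H'⟩)
        (choiceNodes s) := by
  classical
  have hF' : FunArityLE (Language.graph.sum τ) 1 := fun n hn =>
    ⟨fun f => f.elim (fun e => e.elim) (hF n hn).false⟩
  choose d hd using fun p : T => (hTB.pure_terms p p.2).exists_dependsOn hF'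
  -- At most `k` arguments, each depending on one variable, leave one of the `k + 1` variables
  -- unused. For edge atoms the choice of `j` plays no role.
  have hj : ∀ b : B, ∃ j : Fin (k + 1), ∀ R : τ.Relations b.1.1, b.1.2.1 = .inr R →
      ∀ i, d ⟨b.1.2.2 i, hTB.atom_terms b b.2 i⟩ ≠ j := by
    rintro ⟨⟨m, R, ps⟩, hb⟩
    by_cases hm : k < m
    · exact ⟨0, fun R _ => ((hR m hm).false R).elim⟩
    · have : ¬ Function.Surjective fun i => d ⟨ps i, hTB.atom_terms _ hb i⟩ := fun h => by
        have := Fintype.card_le_of_surjective _ h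
        simp only [Fintype.card_fin] at this
        omega
      simp only [Function.Surjective, not_forall, not_exists] at this
      obtain ⟨j, hj⟩ := this
      exact ⟨j, fun _ _ => hj⟩
  choose j hj using hj
  have := hTB.finite_terms.fintype
  have := hTB.finite_atoms.fintype
  obtain ⟨n, hn, hcard⟩ := exists_card_lt hk (Fintype.card T) (Fintype.card B)
  refine ⟨n, hn, fun aux => ?_⟩
  let I : Set (Fin (k + 1) → Fin n) → (Language.graph.sum τ).Structure (CliqueDomain k n) :=
    fun H => State.toStructure ⟨cliqueGraph H, aux H⟩
  let val : Set (Fin (k + 1) → Fin n) → T → (Fin (k + 1) → Fin n) → CliqueDomain k n :=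
    fun H p s => @UTerm.eval _ _ _ (I H) (choiceNodes s) p
  have hval : ∀ H p s s', s (d p) = s' (d p) → val H p s = val H p s' := fun H p s s' h =>
    hd p _ (I H) _ _ (by simp only [choiceNodes, h])
  -- Terms are sampled at constant choices only, because one coordinate determines their value;
  -- atoms are sampled with the unused coordinate fixed at `0`.
  let data : Set (Fin (k + 1) → Fin n) → (T × Fin n → CliqueDomain k n × Prop) ×
      (B × (Fin k → Fin n) → Prop) := fun H =>
    (fun q => (val H q.1 fun _ => q.2, marked H (val H q.1 fun _ => q.2)),
      fun q => q.1.1.Holds (I H) (choiceNodes ((j q.1).insertNth ⟨0, hn⟩ q.2)))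
  -- Pigeonhole: there are more sets of choices than values of `data`.
  obtain ⟨H, H', hdata, hne⟩ := Function.not_injective_iff.1 fun hinj : data.Injective => by
    have := Nat.card_le_card_of_injective data hinj
    simp only [Nat.card_prod, Nat.card_eq_fintype_card, Fintype.card_prod, Fintype.card_sum,
      Fintype.card_set, Fintype.card_fun, Fintype.card_fin, Fintype.card_prop] at this
    exact hcard.not_ge this
  have h₁ : ∀ p s, val H p s = val H' p s ∧ marked H (val H p s) = marked H' (val H' p s) := by
    intro p s
    have := congrFun (congrArg Prod.fst hdata) (p, s (d p))
    simp only [data, Prod.mk.injEq] at this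
    rwa [hval H p s (fun _ => s (d p)) rfl, hval H' p s (fun _ => s (d p)) rfl]
  refine ⟨H, H', hne, fun s => ⟨fun p hp => (h₁ ⟨p, hp⟩ s).1, ?_⟩⟩
  rintro ⟨m, R | R, ps⟩ hb
  · cases R
    let p (i : Fin 2) : T := ⟨ps i, hTB.atom_terms _ hb i⟩
    change cliqueEdge H (val H (p 0) s) (val H (p 1) s) ↔
      cliqueEdge H' (val H' (p 0) s) (val H' (p 1) s)
    rw [← (h₁ (p 0) s).1, ← (h₁ (p 1) s).1]
    exact cliqueEdge_congr ((h₁ (p 0) s).2.trans (by rw [← (h₁ (p 0) s).1])) _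
  · let b : B := ⟨⟨m, .inr R, ps⟩, hb⟩
    -- Resetting the unused coordinate `j b` to `0` changes no argument of the atom.
    have hs : ∀ G, b.1.Holds (I G) (choiceNodes s) ↔ b.1.Holds (I G)
        (choiceNodes ((j b).insertNth ⟨0, hn⟩ ((j b).removeNth s))) := by
      intro G
      refine iff_of_eq (congrArg _ (funext fun i => ?_))
      refine hval G ⟨ps i, hTB.atom_terms _ hb i⟩ _ _ ?_
      have hne := hj b R rfl i
      obtain ⟨l, hl⟩ := Fin.exists_succAbove_eq hne
      change s (d ⟨b.1.2.2 i, hTB.atom_terms b b.2 i⟩) =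
        (j b).insertNth (α := fun _ => Fin n) ⟨0, hn⟩ ((j b).removeNth s)
          (d ⟨b.1.2.2 i, hTB.atom_terms b b.2 i⟩)
      rw [← hl, Fin.insertNth_apply_succAbove]
      rfl
    have h₂ := congrFun (congrArg Prod.snd hdata) (b, (j b).removeNth s)
    exact (hs H).trans ((iff_of_eq h₂).trans (hs H').symm)

end LowerBound

end DynQF

theorem theorem6p1 (k : ℕ) (hk : 1 ≤ k) :
    ¬ ∃ (τaux : FirstOrder.Language.{0, 0})
        (P : DynQF.DynProgram FirstOrder.Language.graph τaux 0),
      DynQF.RelArityLE τaux k ∧ DynQF.FunArityLE τaux 1 ∧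
        P.MaintainsUnderInsertions (DynQF.cliqueQuery (k + 2)) := by
  open DynQF in
  rintro ⟨τ, P, hR, hF, hP⟩
  obtain ⟨ψ, hψ⟩ := P.update.exists_pullback (α := Fin (k + 1))
    (.rel (.inr P.query) Fin.elim0) (groupPairs k)
  obtain ⟨T, B, hTB, hflat⟩ := QFFormula.exists_flat ψ
  obtain ⟨n, hn, h⟩ := hTB.exists_agree hk hR hF
  have : Nonempty (CliqueDomain k n) := ⟨.inl (0, ⟨0, hn⟩)⟩
  obtain ⟨H, H', hne, hA⟩ := h fun H => P.init (CliqueDomain k n) (cliqueGraph H)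
  refine hne (Set.ext fun s => ?_)
  -- The fixed formula `ψ` decodes the whole set from the initial state, since `s` is arbitrary.
  have key : ∀ G, s ∈ G ↔ State.Holds
      ⟨cliqueGraph G, P.init (CliqueDomain k n) (cliqueGraph G)⟩ (choiceNodes s) ψ := by
    intro G
    rw [← hψ, ← cliqueQuery_insert_groupPairs hk G s Fin.elim0]
    have := hP (CliqueDomain k n) (cliqueGraph G)
      ((groupPairs k).map (insertEdge (choiceNodes s))) ?_ Fin.elim0
    · rw [← this]
      simp only [State.Holds, QFFormula.Holds]
      exact iff_of_eq (congrArg _ (funext fun i => i.elim0))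
    · intro m hm
      obtain ⟨e, -, rfl⟩ := List.mem_map.1 hm
      rfl
  rw [key H, key H']
  exact hflat _ _ _ _ (hA s)
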